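/- Let $a,b,c$ be variables, $S_{m,n}=a^mb^n+b^mc^n+c^ma^n$, $S_n=S_{n,0}$, $T_{m,n}=S_{m,n}+S_{n,m}$, $U=abc$, and $$s_0=S_5-US_{1,1},\quad s_1=T_{4,1}-2US_{1,1},\quad s_2=T_{3,2}-2US_{1,1},\quad s_3=US_2-US_{1,1},\quad s_4=US_{1,1}.$$ Let $\mathcal P^{s0+}_{3,5}$ be the convex cone of all symmetric homogeneous polynomials $f\in\mathbb R[a,b,c]$ of degree $5$ (together with $0$) such that $f(x,x,x)=0$ for all $x\in\mathbb R$ and $f\ge 0$ on $\mathbb R_+^3$, where $\mathbb R_+=[0,\infty)$. An extremal ray of a convex cone $\mathcal P$ is a half line $\mathbb R_+\cdot f$ with $f\in\mathcal P\setminus\{0\}$ such that $g,h\in\mathcal P$, $g+h=f$ imply $g,h\in\mathbb R_+\cdot f$. For $t\ge 2$ put $\mu_R(t)=2-t^2+t\sqrt{(t-1)(t+2)}$ and $\mu_B(t)=\frac12\bigl(\mu_R(t)-\sqrt{\mu_R(t)^2-4}\bigr)$. For $t\ge2$ and $u>0$ put $w=\omega(u)=u+\frac1u-2$ and $$\mathfrak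 e^B_{t,u}=s_0-(2w+3)s_1+(w^2+2w+2)s_2+p_3s_3+p_4s_4,$$ $$p_3=-\frac{2t^3+4t^2+5t+1}{t^2(t+2)}w^2+\frac{2(4t^2+5t+3)}{t+2}w-\frac{3t^3-7t^2-12t-8}{t+2},$$ $$p_4=\frac{(t-1)^3\bigl(-w^2-2t^2w+t^2(t-2)\bigr)}{t^2(t+2)}.$$ For $t\ge0$ put $$\mathfrak e^C_t=s_0-(t+1)s_1+ts_2+(t+1)^2s_3,\quad \mathfrak e^D_t=s_1+(t^2-1)s_2-2(t+1)^2s_3,\quad \mathfrak e^D_\infty=s_2-2s_3.$$ Theorem. The extremal rays of $\mathcal P^{s0+}_{3,5}$ are exactly the rays generated by $\mathfrak e^B_{t,\mu_B(t)}$ ($2\le t<\infty$), $\mathfrak e^C_t$ ($0\le t\le2$), $\mathfrak e^D_t$ ($0\le t\le\infty$) and $s_3$. -/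

import Mathlib

namespace QuinticCone

noncomputable section

open MvPolynomial

/-- The real forms (homogeneous polynomials) of degree `d` in `n` variables. -/
abbrev forms (n d : ℕ) : Submodule ℝ (MvPolynomial (Fin n) ℝ) :=
  homogeneousSubmodule (Fin n) ℝ d

/-- The symmetric real forms of degree `d` in `n` variables. -/
def symForms (n d : ℕ) : Submodule ℝ (MvPolynomial (Fin n) ℝ) :=
  forms n d ⊓ Subalgebra.toSubmodule (symmetricSubalgebra (Fin n) ℝ)

/-- The real forms `f` of degree `d` in `n` variables with `f(a, …, a) = 0` for all real `a`. -/
def diagForms (n d : ℕ) : Submodule ℝ (MvPolynomial (Fin n) ℝ) where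
  carrier := {f | f ∈ forms n d ∧ ∀ a : ℝ, eval (fun _ => a) f = 0}
  zero_mem' := ⟨Submodule.zero_mem _, fun _ => map_zero _⟩
  add_mem' := fun hf hg =>
    ⟨Submodule.add_mem _ hf.1 hg.1, fun a => by rw [map_add, hf.2 a, hg.2 a, add_zero]⟩
  smul_mem' := fun c _ hf =>
    ⟨Submodule.smul_mem _ c hf.1, fun a => by rw [smul_eval, hf.2 a, mul_zero]⟩

/-- The symmetric real forms of degree `d` in `n` variables that vanish on the diagonal. -/
def symDiagForms (n d : ℕ) : Submodule ℝ (MvPolynomial (Fin n) ℝ) :=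
  symForms n d ⊓ diagForms n d

/-- The PSD cone on `A` in `H`: the elements of `H` that are nonnegative at every point of `A`. -/
def psdCone {n : ℕ} (A : Set (Fin n → ℝ)) (H : Submodule ℝ (MvPolynomial (Fin n) ℝ)) :
    Set (MvPolynomial (Fin n) ℝ) :=
  {f | f ∈ H ∧ ∀ a ∈ A, 0 ≤ eval a f}

/-- The closed nonnegative orthant `ℝ₊ⁿ`. -/
def orthant (n : ℕ) : Set (Fin n → ℝ) := {a | ∀ i, 0 ≤ a i}

/-- The cone of symmetric forms of degree `d` in `n` variables that vanish on the diagonal and are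
nonnegative on `ℝ₊ⁿ`. -/
def symDiagCone (n d : ℕ) : Set (MvPolynomial (Fin n) ℝ) :=
  psdCone (orthant n) (symDiagForms n d)

/-- The half line `ℝ₊ · f`. -/
def ray {V : Type*} [AddCommGroup V] [Module ℝ V] (f : V) : Set V :=
  {g | ∃ c : ℝ, 0 ≤ c ∧ g = c • f}

/-- `f` is an extremal element of the convex cone `P`: `f` is a nonzero element of `P`, and
`g, h ∈ P` with `g + h = f` forces `g, h ∈ ℝ₊ · f`. -/
def IsExtremalElement {V : Type*} [AddCommGroup V] [Module ℝ V] (P : Set V) (f : V) : Prop :=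
  f ∈ P ∧ f ≠ 0 ∧ ∀ g ∈ P, ∀ h ∈ P, g + h = f → g ∈ ray f ∧ h ∈ ray f

/-- An extremal ray of the convex cone `P` is a half line generated by an extremal element. -/
def IsExtremalRay {V : Type*} [AddCommGroup V] [Module ℝ V] (P : Set V) (R : Set V) : Prop :=
  ∃ f, IsExtremalElement P f ∧ R = ray f

/-- `S_{m,n} = a^m b^n + b^m c^n + c^m a^n`, where `a, b, c` are the variables. -/
def S (m n : ℕ) : MvPolynomial (Fin 3) ℝ :=
  X 0 ^ m * X 1 ^ n + X 1 ^ m * X 2 ^ n + X 2 ^ m * X 0 ^ n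

/-- `T_{m,n} = S_{m,n} + S_{n,m}`. -/
def T (m n : ℕ) : MvPolynomial (Fin 3) ℝ := S m n + S n m

/-- `U = abc`. -/
def U : MvPolynomial (Fin 3) ℝ := X 0 * X 1 * X 2

/-- `s₀ = S₅ - U S_{1,1}`, where `S₅ = S_{5,0}`. -/
def s0 : MvPolynomial (Fin 3) ℝ := S 5 0 - U * S 1 1

/-- `s₁ = T_{4,1} - 2 U S_{1,1}`. -/
def s1 : MvPolynomial (Fin 3) ℝ := T 4 1 - 2 * U * S 1 1

/-- `s₂ = T_{3,2} - 2 U S_{1,1}`. -/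
def s2 : MvPolynomial (Fin 3) ℝ := T 3 2 - 2 * U * S 1 1

/-- `s₃ = U S₂ - U S_{1,1}`, where `S₂ = S_{2,0}`. -/
def s3 : MvPolynomial (Fin 3) ℝ := U * S 2 0 - U * S 1 1

/-- `s₄ = U S_{1,1}`. -/
def s4 : MvPolynomial (Fin 3) ℝ := U * S 1 1

/-- `μ_R(t) = 2 - t² + t √((t - 1)(t + 2))`. -/
def muR (t : ℝ) : ℝ := 2 - t ^ 2 + t * √((t - 1) * (t + 2))

/-- `μ_B(t) = (μ_R(t) - √(μ_R(t)² - 4)) / 2`. -/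
def muB (t : ℝ) : ℝ := (1 / 2) * (muR t - √(muR t ^ 2 - 4))

/-- `ω(u) = u + 1/u - 2`. -/
def omega (u : ℝ) : ℝ := u + 1 / u - 2

/-- The coefficient `p₁ᴮ(t, w)`. -/
def p1B (_t w : ℝ) : ℝ := -2 * w - 3

/-- The coefficient `p₂ᴮ(t, w)`. -/
def p2B (_t w : ℝ) : ℝ := w ^ 2 + 2 * w + 2

/-- The coefficient `p₃ᴮ(t, w)`. -/
def p3B (t w : ℝ) : ℝ :=
  -((2 * t ^ 3 + 4 * t ^ 2 + 5 * t + 1) / (t ^ 2 * (t + 2))) * w ^ 2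
    + 2 * (4 * t ^ 2 + 5 * t + 3) / (t + 2) * w
    - (3 * t ^ 3 - 7 * t ^ 2 - 12 * t - 8) / (t + 2)

/-- The coefficient `p₄ᴮ(t, w)`. -/
def p4B (t w : ℝ) : ℝ :=
  (t - 1) ^ 3 * (-w ^ 2 - 2 * t ^ 2 * w + t ^ 2 * (t - 2)) / (t ^ 2 * (t + 2))

/-- The quintic `𝔢ᴮ_{t,u}`. -/
def eB (t u : ℝ) : MvPolynomial (Fin 3) ℝ :=
  s0 + p1B t (omega u) • s1 + p2B t (omega u) • s2 + p3B t (omega u) • s3 + p4B t (omega u) • s4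

/-- The quintic `𝔢ᶜ_t`. -/
def eC (t : ℝ) : MvPolynomial (Fin 3) ℝ :=
  s0 - (t + 1) • s1 + t • s2 + ((t + 1) ^ 2) • s3

/-- The quintic `𝔢ᴰ_t`, for a finite parameter `t`. -/
def eD (t : ℝ) : MvPolynomial (Fin 3) ℝ :=
  s1 + (t ^ 2 - 1) • s2 - (2 * (t + 1) ^ 2) • s3

/-- The quintic `𝔢ᴰ_∞`. -/
def eDInf : MvPolynomial (Fin 3) ℝ := s2 - 2 * s3

end

end QuinticCone

namespace QuinticCone

open MvPolynomial

/-! The forms in question are a four-dimensional space, written `quintic c p q r`. A symmetric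
quintic is affine in the third elementary symmetric function `u`, since `u ^ 2` already has degree
6. With `s` and `e` fixed, its minimum over the orthant is therefore reached at an end of the range
of `u`, where two variables agree or one vanishes. On these sets the form is, up to nonnegative
factors, the cubic `c t³ + (2p - 4c) t² + r t + 2q` and the quadratic `c w² + p w + q`, so the cone
becomes the set `Admissible` (`quintic_mem_symDiagCone_iff`).

The listed forms are those whose quadratic and cubic have enough zeros: in a decomposition both
summands inherit each zero, doubled if it is interior, and this fixes them up to scale. Conversely,
from an extremal form one can subtract a positive multiple of a listed form and stay in the cone
(`ray_quintic_eq`), so the two rays agree. The case split is on the vanishing of `c` and of `q`. -/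

/-! ### Coordinates on the symmetric quintics vanishing on the diagonal -/

/-- The general element of the span of `s₀, s₁, s₂, s₃`, in coordinates adapted to the
restrictions to the boundary and to the symmetry axis of the orthant. -/
noncomputable def quintic (c p q r : ℝ) : MvPolynomial (Fin 3) ℝ :=
  c • s0 + (p - 3 * c) • s1 + (q + 2 * c - p) • s2 + (r - 2 * p - 2 * q + 5 * c) • s3

/-- The positivity conditions on the coordinates of a quintic: nonnegativity on the boundary and on
the symmetry axis of the orthant. -/
def Admissible (c p q r : ℝ) : Prop :=
  (∀ w : ℝ, 0 ≤ w → 0 ≤ c * w ^ 2 + p * w + q) ∧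
    ∀ t : ℝ, 0 ≤ t → 0 ≤ c * t ^ 3 + (2 * p - 4 * c) * t ^ 2 + r * t + 2 * q

theorem eval_quintic (c p q r : ℝ) (v : Fin 3 → ℝ) :
    eval v (quintic c p q r) =
      c * (v 0 ^ 5 + v 1 ^ 5 + v 2 ^ 5
        - v 0 * v 1 * v 2 * (v 0 * v 1 + v 1 * v 2 + v 2 * v 0)) +
      (p - 3 * c) * (v 0 ^ 4 * v 1 + v 1 ^ 4 * v 2 + v 2 ^ 4 * v 0
        + (v 0 * v 1 ^ 4 + v 1 * v 2 ^ 4 + v 2 * v 0 ^ 4)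
        - 2 * (v 0 * v 1 * v 2) * (v 0 * v 1 + v 1 * v 2 + v 2 * v 0)) +
      (q + 2 * c - p) * (v 0 ^ 3 * v 1 ^ 2 + v 1 ^ 3 * v 2 ^ 2 + v 2 ^ 3 * v 0 ^ 2
        + (v 0 ^ 2 * v 1 ^ 3 + v 1 ^ 2 * v 2 ^ 3 + v 2 ^ 2 * v 0 ^ 3)
        - 2 * (v 0 * v 1 * v 2) * (v 0 * v 1 + v 1 * v 2 + v 2 * v 0)) +
      (r - 2 * p - 2 * q + 5 * c) * (v 0 * v 1 * v 2 * (v 0 ^ 2 + v 1 ^ 2 + v 2 ^ 2)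
        - v 0 * v 1 * v 2 * (v 0 * v 1 + v 1 * v 2 + v 2 * v 0)) := by
  simp [quintic, s0, s1, s2, s3, T, S, U, smul_eval]

theorem quintic_add (c p q r c' p' q' r' : ℝ) :
    quintic c p q r + quintic c' p' q' r' = quintic (c + c') (p + p') (q + q') (r + r') := by
  unfold quintic; module

theorem smul_quintic (k c p q r : ℝ) :
    k • quintic c p q r = quintic (k * c) (k * p) (k * q) (k * r) := by
  unfold quintic; module

theorem quintic_sub (c p q r c' p' q' r' : ℝ) :
    quintic c p q r - quintic c' p' q' r' = quintic (c - c') (p - p') (q - q') (r - r') := by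
  unfold quintic; module

theorem quintic_inj {c p q r c' p' q' r' : ℝ} (h : quintic c p q r = quintic c' p' q' r') :
    c = c' ∧ p = p' ∧ q = q' ∧ r = r' := by
  have e (v : Fin 3 → ℝ) := congrArg (eval v) h
  simp only [eval_quintic] at e
  have h1 := e ![0, 0, 1]
  have h2 := e ![0, 1, 1]
  have h3 := e ![0, 1, 2]
  have h4 := e ![2, 1, 1]
  simp at h1 h2 h3 h4
  subst h1
  refine ⟨rfl, ?_, ?_, ?_⟩ <;> linarith

theorem quintic_isSymmetric (c p q r : ℝ) : (quintic c p q r).IsSymmetric := by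
  intro e
  have he : ∀ e : Equiv.Perm (Fin 3),
      (e 0 = 0 ∧ e 1 = 1 ∧ e 2 = 2) ∨ (e 0 = 0 ∧ e 1 = 2 ∧ e 2 = 1) ∨
      (e 0 = 1 ∧ e 1 = 0 ∧ e 2 = 2) ∨ (e 0 = 1 ∧ e 1 = 2 ∧ e 2 = 0) ∨
      (e 0 = 2 ∧ e 1 = 0 ∧ e 2 = 1) ∨ (e 0 = 2 ∧ e 1 = 1 ∧ e 2 = 0) := by decide
  refine MvPolynomial.funext fun v => ?_
  rw [eval_rename, eval_quintic, eval_quintic]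
  simp only [Function.comp]
  rcases he e with ⟨h0, h1, h2⟩ | ⟨h0, h1, h2⟩ | ⟨h0, h1, h2⟩ | ⟨h0, h1, h2⟩ | ⟨h0, h1, h2⟩ |
    ⟨h0, h1, h2⟩ <;> rw [h0, h1, h2] <;> ring

theorem S_isHomogeneous (m n : ℕ) : (S m n).IsHomogeneous (m + n) := by
  unfold S
  exact ((((isHomogeneous_X_pow _ _).mul (isHomogeneous_X_pow _ _)).add
    ((isHomogeneous_X_pow _ _).mul (isHomogeneous_X_pow _ _))).add
    ((isHomogeneous_X_pow _ _).mul (isHomogeneous_X_pow _ _)))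

theorem U_isHomogeneous : U.IsHomogeneous 3 :=
  ((isHomogeneous_X _ _).mul (isHomogeneous_X _ _)).mul (isHomogeneous_X _ _)

theorem quintic_isHomogeneous (c p q r : ℝ) : (quintic c p q r).IsHomogeneous 5 := by
  have hU (m n : ℕ) (h : m + n = 2) : U * S m n ∈ forms 3 5 := by
    have := U_isHomogeneous.mul (S_isHomogeneous m n)
    rw [h] at this
    exact this
  have hS (m n : ℕ) (h : m + n = 5) : S m n ∈ forms 3 5 := by
    have := S_isHomogeneous m n
    rw [h] at this
    exact this
  have h2 : 2 * U * S 1 1 ∈ forms 3 5 := by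
    rw [mul_assoc, two_mul]
    exact add_mem (hU 1 1 rfl) (hU 1 1 rfl)
  change quintic c p q r ∈ forms 3 5
  refine add_mem (add_mem (add_mem ?_ ?_) ?_) ?_ <;> refine Submodule.smul_mem _ _ ?_
  · exact sub_mem (hS 5 0 rfl) (hU 1 1 rfl)
  · exact sub_mem (add_mem (hS 4 1 rfl) (hS 1 4 rfl)) h2
  · exact sub_mem (add_mem (hS 3 2 rfl) (hS 2 3 rfl)) h2
  · exact sub_mem (hU 2 0 rfl) (hU 1 1 rfl)

theorem quintic_mem_symDiagForms (c p q r : ℝ) : quintic c p q r ∈ symDiagForms 3 5 := by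
  refine ⟨⟨quintic_isHomogeneous c p q r, ?_⟩, quintic_isHomogeneous c p q r, fun a => ?_⟩
  · exact quintic_isSymmetric c p q r
  · rw [eval_quintic]; ring

/-- The exponent of the monomial `a^i b^j c^k`. -/
noncomputable def exponent (i j k : ℕ) : Fin 3 →₀ ℕ := Finsupp.equivFunOnFinite.symm ![i, j, k]

theorem eval_of_isHomogeneous {f : MvPolynomial (Fin 3) ℝ} {n : ℕ} (hf : f.IsHomogeneous n)
    (v : Fin 3 → ℝ) :
    eval v f = ∑ x ∈ Finset.Nat.antidiagonalTuple 3 n,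
      coeff (exponent (x 0) (x 1) (x 2)) f * (v 0 ^ x 0 * v 1 ^ x 1 * v 2 ^ x 2) := by
  have hx (x : Fin 3 → ℕ) : exponent (x 0) (x 1) (x 2) = Finsupp.equivFunOnFinite.symm x := by
    ext i; fin_cases i <;> rfl
  have hsub : f.support ⊆ (Finset.Nat.antidiagonalTuple 3 n).map
      Finsupp.equivFunOnFinite.symm.toEmbedding := by
    intro d hd
    rw [Finset.mem_map]
    refine ⟨d, ?_, by ext; simp⟩
    rw [Finset.Nat.mem_antidiagonalTuple]
    have := hf (mem_support_iff.1 hd)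
    rw [Finsupp.weight_apply, Finsupp.sum_fintype _ _ (by simp)] at this
    simpa using this
  rw [eval_eq', Finset.sum_subset hsub, Finset.sum_map]
  · refine Finset.sum_congr rfl fun x _ => ?_
    rw [hx, Fin.prod_univ_three]
    rfl
  · intro d _ hd
    rw [notMem_support_iff.1 hd, zero_mul]

theorem coeff_exponent_swap {f : MvPolynomial (Fin 3) ℝ} (hf : f.IsSymmetric) (i j k : ℕ) :
    coeff (exponent i j k) f = coeff (exponent j i k) f ∧
      coeff (exponent i j k) f = coeff (exponent i k j) f := by
  have key (e : Equiv.Perm (Fin 3)) (d : Fin 3 →₀ ℕ) :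
      coeff (d.mapDomain e) f = coeff d f := by
    conv_lhs => rw [← hf e]
    exact coeff_rename_mapDomain _ e.injective _ _
  constructor
  · rw [← key (Equiv.swap 0 1)]
    congr 1
    ext x
    rw [← Finsupp.equivMapDomain_eq_mapDomain]
    fin_cases x <;> rfl
  · rw [← key (Equiv.swap 1 2)]
    congr 1
    ext x
    rw [← Finsupp.equivMapDomain_eq_mapDomain]
    fin_cases x <;> rfl

/-- Symmetry leaves one coefficient for each of the five partitions of 5 into at most three parts;
vanishing at `(1, 1, 1)` eliminates that of `U * S 1 1`. -/
theorem exists_eq_quintic {f : MvPolynomial (Fin 3) ℝ} (hf : f ∈ symDiagForms 3 5) :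
    ∃ c p q r, f = quintic c p q r := by
  obtain ⟨⟨hh, hs⟩, -, hd⟩ := hf
  have hs' : f.IsSymmetric := hs
  have ev := eval_of_isHomogeneous (n := 5) (f := f) hh
  have h12 (i j k) := (coeff_exponent_swap hs' i j k).1
  have h23 (i j k) := (coeff_exponent_swap hs' i j k).2
  have hA : Finset.Nat.antidiagonalTuple 3 5 = {![0,0,5], ![0,1,4], ![0,2,3], ![0,3,2], ![0,4,1],
    ![0,5,0], ![1,0,4], ![1,1,3], ![1,2,2], ![1,3,1], ![1,4,0], ![2,0,3], ![2,1,2], ![2,2,1],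
    ![2,3,0], ![3,0,2], ![3,1,1], ![3,2,0], ![4,0,1], ![4,1,0], ![5,0,0]} := by decide
  have ev' (v : Fin 3 → ℝ) : eval v f =
      coeff (exponent 5 0 0) f * (v 0 ^ 5 + v 1 ^ 5 + v 2 ^ 5) +
      coeff (exponent 4 1 0) f * (v 0 ^ 4 * v 1 + v 1 ^ 4 * v 2 + v 2 ^ 4 * v 0
        + (v 0 * v 1 ^ 4 + v 1 * v 2 ^ 4 + v 2 * v 0 ^ 4)) +
      coeff (exponent 3 2 0) f * (v 0 ^ 3 * v 1 ^ 2 + v 1 ^ 3 * v 2 ^ 2 + v 2 ^ 3 * v 0 ^ 2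
        + (v 0 ^ 2 * v 1 ^ 3 + v 1 ^ 2 * v 2 ^ 3 + v 2 ^ 2 * v 0 ^ 3)) +
      coeff (exponent 3 1 1) f * (v 0 * v 1 * v 2 * (v 0 ^ 2 + v 1 ^ 2 + v 2 ^ 2)) +
      coeff (exponent 2 2 1) f * (v 0 * v 1 * v 2 * (v 0 * v 1 + v 1 * v 2 + v 2 * v 0)) := by
    rw [ev, hA]
    repeat rw [Finset.sum_insert (by decide)]
    rw [Finset.sum_singleton]
    simp only [Matrix.cons_val_zero, Matrix.cons_val_one, Matrix.cons_val]
    rw [h23 0 0 5, h12 0 5 0, h23 0 1 4, h12 0 4 1, h23 4 0 1, h23 0 2 3, h12 0 3 2, h23 3 0 2,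
      h12 1 0 4, h23 0 1 4, h12 0 4 1, h23 4 0 1, h23 1 1 3, h12 1 3 1, h12 1 2 2, h23 2 1 2,
      h12 1 4 0, h12 2 0 3, h23 0 2 3, h12 0 3 2, h23 3 0 2, h12 2 3 0]
    ring
  have hd1 := hd 1
  rw [ev'] at hd1
  refine ⟨coeff (exponent 5 0 0) f, coeff (exponent 4 1 0) f + 3 * coeff (exponent 5 0 0) f,
    coeff (exponent 3 2 0) f + coeff (exponent 4 1 0) f + coeff (exponent 5 0 0) f,
    coeff (exponent 3 1 1) f + 2 * (coeff (exponent 4 1 0) f + 3 * coeff (exponent 5 0 0) f)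
      + 2 * (coeff (exponent 3 2 0) f + coeff (exponent 4 1 0) f + coeff (exponent 5 0 0) f)
      - 5 * coeff (exponent 5 0 0) f, MvPolynomial.funext fun v => ?_⟩
  rw [ev', eval_quintic]
  linear_combination
    (v 0 * v 1 * v 2 * (v 0 * v 1 + v 1 * v 2 + v 2 * v 0)) / 3 * hd1

/-! ### Reduction of nonnegativity to the boundary and the symmetry axis -/

theorem Admissible.axis_nonneg {c p q r : ℝ} (h : Admissible c p q r) {x y : ℝ} (hx : 0 ≤ x)
    (hy : 0 ≤ y) :
    0 ≤ c * x ^ 3 + (2 * p - 4 * c) * x ^ 2 * y + r * x * y ^ 2 + 2 * q * y ^ 3 := by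
  rcases hy.eq_or_lt with rfl | hy
  · have hc : 0 ≤ c := by
      by_contra! hc
      -- For `c < 0` this point is large enough to make the boundary quadratic negative.
      have h0 := h.1 ((|p| + |q| + 1) / -c + 1) (by positivity [neg_pos.2 hc])
      set w := (|p| + |q| + 1) / -c + 1 with hw
      have hw1 : 1 ≤ w := by
        have : 0 ≤ (|p| + |q| + 1) / -c := div_nonneg (by positivity) (by linarith)
        linarith
      have hcw : c * w = -(|p| + |q| + 1) + c := by
        have := hc.ne
        rw [hw]; field_simp
      nlinarith [le_abs_self p, le_abs_self q, abs_nonneg p, abs_nonneg q]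
    have := pow_nonneg hx 3
    nlinarith
  · have h1 := h.2 (x / y) (by positivity)
    have h2 : c * x ^ 3 + (2 * p - 4 * c) * x ^ 2 * y + r * x * y ^ 2 + 2 * q * y ^ 3 =
        (c * (x / y) ^ 3 + (2 * p - 4 * c) * (x / y) ^ 2 + r * (x / y) + 2 * q) * y ^ 3 := by
      field_simp
    rw [h2]
    positivity

theorem Admissible.leading_nonneg {c p q r : ℝ} (h : Admissible c p q r) : 0 ≤ c := by
  simpa using h.axis_nonneg zero_le_one le_rfl

theorem Admissible.linear_nonneg {p q r : ℝ} (h : Admissible 0 p q r) : 0 ≤ p := by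
  by_contra! hp
  have h1 := h.1 ((|q| + 1) / -p) (div_nonneg (by positivity) (by linarith))
  have : p * ((|q| + 1) / -p) = -(|q| + 1) := by
    have := hp.ne
    field_simp
  linarith [le_abs_self q]

theorem Admissible.constant_nonneg {c p q r : ℝ} (h : Admissible c p q r) : 0 ≤ q := by
  simpa using h.1 0 le_rfl

/-- The value of `quintic c p q r` at a point with elementary symmetric functions `s, e, u`. -/
noncomputable def symmetricValue (c p q r s e u : ℝ) : ℝ :=
  c * (s ^ 5 - 5 * s ^ 3 * e + 5 * s * e ^ 2 + 5 * s ^ 2 * u - 6 * e * u) +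
    (p - 3 * c) * (s ^ 3 * e - 3 * s * e ^ 2 - s ^ 2 * u + 3 * e * u) +
    (q + 2 * c - p) * (s * e ^ 2 - 2 * s ^ 2 * u - 3 * e * u) +
    (r - 2 * p - 2 * q + 5 * c) * (s ^ 2 * u - 3 * e * u)

theorem eval_quintic_eq_symmetricValue (c p q r : ℝ) (v : Fin 3 → ℝ) :
    eval v (quintic c p q r) = symmetricValue c p q r (v 0 + v 1 + v 2)
      (v 0 * v 1 + v 1 * v 2 + v 2 * v 0) (v 0 * v 1 * v 2) := by
  rw [eval_quintic, symmetricValue]; ring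

theorem Admissible.symmetricValue_axis {c p q r : ℝ} (h : Admissible c p q r) {x y : ℝ}
    (hx : 0 ≤ x) (hy : 0 ≤ y) :
    0 ≤ symmetricValue c p q r (x + 2 * y) (2 * x * y + y ^ 2) (x * y ^ 2) := by
  have h1 : symmetricValue c p q r (x + 2 * y) (2 * x * y + y ^ 2) (x * y ^ 2) =
      (x - y) ^ 2 *
        (c * x ^ 3 + (2 * p - 4 * c) * x ^ 2 * y + r * x * y ^ 2 + 2 * q * y ^ 3) := by
    rw [symmetricValue]; ring
  rw [h1]
  exact mul_nonneg (sq_nonneg _) (h.axis_nonneg hx hy)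

/-- At a boundary point `(0, y, z)` the quadratic is evaluated at `w = (y - z)² / (y z) = (s² - 4e)
/ e`. -/
theorem Admissible.symmetricValue_boundary {c p q r : ℝ} (h : Admissible c p q r) {s e : ℝ}
    (hs : 0 ≤ s) (he : 0 ≤ e) (hse : 4 * e ≤ s ^ 2) :
    0 ≤ symmetricValue c p q r s e 0 := by
  rcases he.eq_or_lt with rfl | he
  · have h1 : symmetricValue c p q r s 0 0 = c * s ^ 5 := by
      rw [symmetricValue]; ring
    rw [h1]
    exact mul_nonneg h.leading_nonneg (by positivity)
  · have h1 := h.1 ((s ^ 2 - 4 * e) / e) (div_nonneg (by linarith) he.le)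
    have h2 : symmetricValue c p q r s e 0 = s * e ^ 2 *
        (c * ((s ^ 2 - 4 * e) / e) ^ 2 + p * ((s ^ 2 - 4 * e) / e) + q) := by
      rw [symmetricValue]; field_simp; ring
    rw [h2]
    positivity

/-- The value is affine in `u`, hence nonnegative between two points where it is nonnegative. -/
theorem symmetricValue_nonneg_of_between {c p q r s e u u₁ u₂ : ℝ}
    (h1 : 0 ≤ symmetricValue c p q r s e u₁) (h2 : 0 ≤ symmetricValue c p q r s e u₂)
    (hu1 : u₁ ≤ u) (hu2 : u ≤ u₂) : 0 ≤ symmetricValue c p q r s e u := by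
  rcases hu1.eq_or_lt with rfl | hu1
  · exact h1
  · have h3 : (u₂ - u₁) * symmetricValue c p q r s e u =
        (u₂ - u) * symmetricValue c p q r s e u₁ + (u - u₁) * symmetricValue c p q r s e u₂ := by
      simp only [symmetricValue]; ring
    have h4 : 0 ≤ (u₂ - u₁) * symmetricValue c p q r s e u := by
      rw [h3]
      exact add_nonneg (mul_nonneg (by linarith) h1) (mul_nonneg (by linarith) h2)
    exact nonneg_of_mul_nonneg_right h4 (by linarith)

/-- With `d² = s² - 3e`, the real-rootedness of the cubic with roots `x, y, z` confines `27u` to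
`[(s + d)² (s - 2d), (s - d)² (s + 2d)]`. Both ends come from triples with two equal entries. If `s
< 2d`, the lower one leaves the orthant and `u = 0` replaces it. -/
theorem Admissible.eval_nonneg {c p q r : ℝ} (h : Admissible c p q r) {v : Fin 3 → ℝ}
    (hv : ∀ i, 0 ≤ v i) : 0 ≤ eval v (quintic c p q r) := by
  rw [eval_quintic_eq_symmetricValue]
  have hx := hv 0
  have hy := hv 1
  have hz := hv 2
  generalize v 0 = x at *
  generalize v 1 = y at *
  generalize v 2 = z at *
  have hD : 0 ≤ (x + y + z) ^ 2 - 3 * (x * y + y * z + z * x) := by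
    nlinarith [sq_nonneg (x - y), sq_nonneg (y - z), sq_nonneg (z - x)]
  obtain ⟨d, hd, hd2⟩ : ∃ d : ℝ, 0 ≤ d ∧ d ^ 2 = (x + y + z) ^ 2 - 3 * (x * y + y * z + z * x) :=
    ⟨_, Real.sqrt_nonneg _, Real.sq_sqrt hD⟩
  have hU : 0 ≤ x * y * z := by positivity
  have he : 0 ≤ x * y + y * z + z * x := by positivity
  have hs : 0 ≤ x + y + z := by positivity
  -- The right side is 27 times the discriminant of the cubic with roots `x, y, z`.
  have hdisc : (27 * (x * y * z) - (x + y + z + d) ^ 2 * (x + y + z - 2 * d)) *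
      ((x + y + z - d) ^ 2 * (x + y + z + 2 * d) - 27 * (x * y * z)) =
      27 * ((x - y) * (y - z) * (z - x)) ^ 2 := by
    have h4 : d ^ 4 = ((x + y + z) ^ 2 - 3 * (x * y + y * z + z * x)) ^ 2 := by
      rw [← hd2]; ring
    have h6 : d ^ 6 = ((x + y + z) ^ 2 - 3 * (x * y + y * z + z * x)) ^ 3 := by
      rw [← hd2]; ring
    generalize hK : x + y + z = s at *
    have hexp : (27 * (x * y * z) - (s + d) ^ 2 * (s - 2 * d)) *
        ((s - d) ^ 2 * (s + 2 * d) - 27 * (x * y * z)) =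
        4 * d ^ 6 - (27 * (x * y * z) - s ^ 3 + 3 * s * d ^ 2) ^ 2 := by ring
    rw [hexp, h6, hd2, ← hK]
    ring
  generalize hse : x + y + z = s at *
  generalize hee : x * y + y * z + z * x = e at *
  generalize hue : x * y * z = u at *
  have hgap : (s - d) ^ 2 * (s + 2 * d) - (s + d) ^ 2 * (s - 2 * d) = 4 * d ^ 3 := by ring
  have hd3 : 0 ≤ d ^ 3 := by positivity
  have hpos : 0 ≤ (27 * u - (s + d) ^ 2 * (s - 2 * d)) *
      ((s - d) ^ 2 * (s + 2 * d) - 27 * u) := by rw [hdisc]; positivity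
  have hlow : (s + d) ^ 2 * (s - 2 * d) ≤ 27 * u := by
    by_contra! hlt
    nlinarith
  have hupp : 27 * u ≤ (s - d) ^ 2 * (s + 2 * d) := by
    by_contra! hlt
    nlinarith
  have hds : d ≤ s := by nlinarith
  have hmax : 0 ≤ symmetricValue c p q r s e ((s - d) ^ 2 * (s + 2 * d) / 27) := by
    have := h.symmetricValue_axis (x := (s + 2 * d) / 3) (y := (s - d) / 3) (by linarith)
      (by linarith)
    convert this using 1
    congr 1
    · ring
    · linear_combination hd2 / 3
    · ring
  rcases le_total (2 * d) s with hsd | hsd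
  · refine symmetricValue_nonneg_of_between (u₁ := (s + d) ^ 2 * (s - 2 * d) / 27) ?_ hmax
      (by linarith) (by linarith)
    have := h.symmetricValue_axis (x := (s - 2 * d) / 3) (y := (s + d) / 3) (by linarith)
      (by linarith)
    convert this using 1
    congr 1
    · ring
    · linear_combination hd2 / 3
    · ring
  · exact symmetricValue_nonneg_of_between
      (h.symmetricValue_boundary hs he (by nlinarith)) hmax hU (by linarith)

theorem quintic_mem_symDiagCone_iff {c p q r : ℝ} :
    quintic c p q r ∈ symDiagCone 3 5 ↔ Admissible c p q r := by
  refine ⟨fun ⟨_, h⟩ => ⟨fun w hw => ?_, fun t ht => ?_⟩,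
    fun h => ⟨quintic_mem_symDiagForms c p q r, fun v hv => h.eval_nonneg hv⟩⟩
  · have h4 : √(w + 4) ^ 2 = w + 4 := Real.sq_sqrt (by linarith)
    have h1 : √w ^ 2 = w := Real.sq_sqrt hw
    have hle : √w ≤ √(w + 4) := Real.sqrt_le_sqrt (by linarith)
    have hs : 0 < √(w + 4) := Real.sqrt_pos.2 (by linarith)
    -- The two nonzero entries have product 1 and squared difference `w`.
    have hv := h ![0, (√(w + 4) + √w) / 2, (√(w + 4) - √w) / 2] (by
      intro i
      fin_cases i
      · exact le_rfl
      · change 0 ≤ (√(w + 4) + √w) / 2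
        positivity
      · change 0 ≤ (√(w + 4) - √w) / 2
        linarith)
    rw [eval_quintic_eq_symmetricValue] at hv
    simp only [Matrix.cons_val_zero, Matrix.cons_val_one, Matrix.cons_val] at hv
    generalize √(w + 4) = s at *
    generalize √w = d at *
    have he : 0 * ((s + d) / 2) + (s + d) / 2 * ((s - d) / 2) + (s - d) / 2 * 0 = 1 := by
      linear_combination h4 / 4 - h1 / 4
    have hs' : 0 + (s + d) / 2 + (s - d) / 2 = s := by ring
    rw [he, hs'] at hv
    have hval : symmetricValue c p q r s 1 (0 * ((s + d) / 2) * ((s - d) / 2)) =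
        s * (c * w ^ 2 + p * w + q) := by
      have hw4 : w = s ^ 2 - 4 := by linarith
      rw [symmetricValue, hw4]
      ring
    rw [hval] at hv
    exact nonneg_of_mul_nonneg_right hv hs
  · have key (t : ℝ) (ht : 0 ≤ t) (h1 : t ≠ 1) :
        0 ≤ c * t ^ 3 + (2 * p - 4 * c) * t ^ 2 + r * t + 2 * q := by
      have hv := h ![t, 1, 1] (by
        intro i
        fin_cases i
        · exact ht
        · exact zero_le_one
        · exact zero_le_one)
      rw [eval_quintic] at hv
      simp only [Matrix.cons_val_zero, Matrix.cons_val_one, Matrix.cons_val] at hv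
      have h2 : 0 < (t - 1) ^ 2 := by
        have := sub_ne_zero.2 h1
        positivity
      refine nonneg_of_mul_nonneg_right (a := (t - 1) ^ 2) ?_ h2
      linarith
    rcases ne_or_eq t 1 with h1 | rfl
    · exact key t ht h1
    -- The factor `(t - 1)²` cannot be cancelled at `t = 1`; a limit from the right gives this
    -- value.
    · have hc : Continuous fun t : ℝ => c * t ^ 3 + (2 * p - 4 * c) * t ^ 2 + r * t + 2 * q := by
        fun_prop
      refine ge_of_tendsto (hc.continuousWithinAt (s := Set.Ioi 1) (x := 1)) ?_
      filter_upwards [self_mem_nhdsWithin] with t ht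
      exact key t (by linarith [Set.mem_Ioi.1 ht]) (Set.mem_Ioi.1 ht).ne'

/-! ### The listed quintics in coordinates -/

theorem muR_spec {t : ℝ} (ht : 2 ≤ t) :
    0 ≤ muR t - 2 ∧ (muR t - 2) ^ 2 + 2 * t ^ 2 * (muR t - 2) = t ^ 2 * (t - 2) := by
  have hs : √((t - 1) * (t + 2)) ^ 2 = (t - 1) * (t + 2) := Real.sq_sqrt (by nlinarith)
  have hle : t ≤ √((t - 1) * (t + 2)) := Real.le_sqrt_of_sq_le (by nlinarith)
  unfold muR
  generalize √((t - 1) * (t + 2)) = s at *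
  constructor
  · nlinarith
  · linear_combination t ^ 2 * hs

/-- `muB t` is a root of `u² - (muR t) u + 1`, so `u + 1/u = muR t`. -/
theorem omega_muB {t : ℝ} (ht : 2 ≤ t) : omega (muB t) = muR t - 2 := by
  have hm := (muR_spec ht).1
  have hs : √(muR t ^ 2 - 4) ^ 2 = muR t ^ 2 - 4 := Real.sq_sqrt (by nlinarith)
  have hs0 := Real.sqrt_nonneg (muR t ^ 2 - 4)
  unfold omega muB
  generalize muR t = m at *
  generalize √(m ^ 2 - 4) = s at *
  have hpos : 0 < m - s := by nlinarith
  field_simp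
  linear_combination hs

/-- The positive parameter `w` attached to `t` determines it through
`w² + 2t²w = t²(t - 2)`. -/
theorem muR_sub_two_eq {t w : ℝ} (ht : 2 ≤ t) (hw : 0 ≤ w)
    (h : w ^ 2 + 2 * t ^ 2 * w = t ^ 2 * (t - 2)) : muR t - 2 = w := by
  obtain ⟨h0, h1⟩ := muR_spec ht
  have h2 : (muR t - 2 - w) * (muR t - 2 + w + 2 * t ^ 2) = 0 := by linear_combination h1 - h
  rcases mul_eq_zero.1 h2 with h3 | h3
  · linarith
  · nlinarith

/-- The relation in `muR_spec` is exactly the vanishing of `p4B`. -/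
theorem eB_muB_eq_quintic {t : ℝ} (ht : 2 ≤ t) :
    eB t (muB t) = quintic 1 (-2 * (muR t - 2)) ((muR t - 2) ^ 2)
      (t ^ 2 - 4 * (muR t - 2) ^ 2 / t) := by
  have hw := (muR_spec ht).2
  rw [eB, omega_muB ht, quintic]
  generalize muR t - 2 = w at *
  have ht0 : t ≠ 0 := by linarith
  have ht2 : t + 2 ≠ 0 := by linarith
  have h4 : p4B t w = 0 := by
    rw [p4B, show -w ^ 2 - 2 * t ^ 2 * w + t ^ 2 * (t - 2) = 0 by linarith]
    simp
  have hw2 : w ^ 2 = t ^ 2 * (t - 2 - 2 * w) := by linear_combination hw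
  have h3 : p3B t w = t ^ 2 - 4 * w ^ 2 / t - 2 * (-2 * w) - 2 * w ^ 2 + 5 * 1 := by
    rw [p3B, hw2]
    field_simp
    ring
  rw [h4, h3, p1B, p2B]
  module

theorem eC_eq_quintic (t : ℝ) : eC t = quintic 1 (2 - t) 0 (t ^ 2) := by
  unfold eC quintic; module

theorem eD_eq_quintic (t : ℝ) : eD t = quintic 0 1 (t ^ 2) (-4 * t) := by
  unfold eD quintic; module

theorem eDInf_eq_quintic : eDInf = quintic 0 0 1 0 := by
  rw [eDInf, two_mul, quintic]; module

theorem s3_eq_quintic : s3 = quintic 0 0 0 1 := by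
  unfold quintic; module

theorem quintic_zero : quintic 0 0 0 0 = 0 := by
  unfold quintic; module

/-- The boundary quadratic is `(x - w)²`, and the relation between `t` and `w` gives the cubic a
double root at `t`. -/
theorem admissible_eB {t w : ℝ} (ht : 2 ≤ t)
    (h : w ^ 2 + 2 * t ^ 2 * w = t ^ 2 * (t - 2)) :
    Admissible 1 (-2 * w) (w ^ 2) (t ^ 2 - 4 * w ^ 2 / t) := by
  refine ⟨fun x _ => by nlinarith [sq_nonneg (x - w)], fun x hx => ?_⟩
  have ht0 : 0 < t := by linarith
  have h1 : 1 * x ^ 3 + (2 * (-2 * w) - 4 * 1) * x ^ 2 + (t ^ 2 - 4 * w ^ 2 / t) * x + 2 * w ^ 2 =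
      (x - t) ^ 2 * (x + 2 * w ^ 2 / t ^ 2) := by
    field_simp
    linear_combination (-2 * x ^ 2) * h
  rw [h1]
  positivity

theorem admissible_eC {t : ℝ} (ht : t ≤ 2) : Admissible 1 (2 - t) 0 (t ^ 2) := by
  refine ⟨fun x hx => ?_, fun x hx => ?_⟩
  · nlinarith [mul_nonneg (sub_nonneg.2 ht) hx, sq_nonneg x]
  · nlinarith [mul_nonneg hx (sq_nonneg (x - t))]

theorem admissible_eD (t : ℝ) : Admissible 0 1 (t ^ 2) (-4 * t) :=
  ⟨fun x hx => by nlinarith [sq_nonneg t], fun x _ => by nlinarith [sq_nonneg (x - t)]⟩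

theorem admissible_eDInf : Admissible 0 0 1 0 :=
  ⟨fun x _ => by norm_num, fun x _ => by norm_num⟩

theorem admissible_s3 : Admissible 0 0 0 1 :=
  ⟨fun x _ => by norm_num, fun x hx => by linarith⟩

/-! ### Tools for extremal rays -/

section Rays

variable {V : Type*} [AddCommGroup V] [Module ℝ V]

theorem ray_smul {k : ℝ} (hk : 0 < k) (e : V) : ray (k • e) = ray e := by
  ext g
  constructor
  · rintro ⟨c, hc, rfl⟩
    exact ⟨c * k, by positivity, smul_smul c k e⟩
  · rintro ⟨c, hc, rfl⟩
    exact ⟨c / k, by positivity, by rw [smul_smul, div_mul_cancel₀ _ hk.ne']⟩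

theorem IsExtremalElement.ray_eq {P : Set V} {f e : V} (hf : IsExtremalElement P f) {k : ℝ}
    (hk : 0 < k) (he : e ≠ 0) (h1 : k • e ∈ P) (h2 : f - k • e ∈ P) : ray f = ray e := by
  obtain ⟨c, hc, h⟩ := (hf.2.2 _ h1 _ h2 (by abel)).1
  have hc0 : c ≠ 0 := by
    rintro rfl
    rw [zero_smul] at h
    exact (smul_ne_zero hk.ne' he) h
  rw [← ray_smul hk e, h, ray_smul (lt_of_le_of_ne hc hc0.symm)]

end Rays

theorem Admissible.smul {c p q r k : ℝ} (h : Admissible c p q r) (hk : 0 ≤ k) :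
    Admissible (k * c) (k * p) (k * q) (k * r) := by
  refine ⟨fun x hx => ?_, fun x hx => ?_⟩
  · have := mul_nonneg hk (h.1 x hx)
    linarith
  · have := mul_nonneg hk (h.2 x hx)
    linarith

/-- To find the ray of an extremal quintic, subtract a positive multiple of a known one. -/
theorem ray_quintic_eq {c p q r c' p' q' r' : ℝ}
    (hf : IsExtremalElement (symDiagCone 3 5) (quintic c p q r)) {k : ℝ} (hk : 0 < k)
    (he : Admissible c' p' q' r') (h0 : quintic c' p' q' r' ≠ 0)
    (h : Admissible (c - k * c') (p - k * p') (q - k * q') (r - k * r')) :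
    ray (quintic c p q r) = ray (quintic c' p' q' r') := by
  refine hf.ray_eq hk h0 ?_ ?_
  · rw [smul_quintic, quintic_mem_symDiagCone_iff]
    exact he.smul hk.le
  · rw [smul_quintic, quintic_sub, quintic_mem_symDiagCone_iff]
    exact h

/-- The hypothesis `key` speaks of the first summand only; exchanging the summands gives the second.
-/
theorem isExtremalElement_quintic {c p q r : ℝ} (h : Admissible c p q r)
    (h0 : quintic c p q r ≠ 0)
    (key : ∀ c₁ p₁ q₁ r₁ c₂ p₂ q₂ r₂ : ℝ, Admissible c₁ p₁ q₁ r₁ → Admissible c₂ p₂ q₂ r₂ →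
      c₁ + c₂ = c → p₁ + p₂ = p → q₁ + q₂ = q → r₁ + r₂ = r →
      ∃ k, 0 ≤ k ∧ c₁ = k * c ∧ p₁ = k * p ∧ q₁ = k * q ∧ r₁ = k * r) :
    IsExtremalElement (symDiagCone 3 5) (quintic c p q r) := by
  refine ⟨quintic_mem_symDiagCone_iff.2 h, h0, fun g hg g' hg' hsum => ?_⟩
  obtain ⟨c₁, p₁, q₁, r₁, rfl⟩ := exists_eq_quintic hg.1
  obtain ⟨c₂, p₂, q₂, r₂, rfl⟩ := exists_eq_quintic hg'.1
  rw [quintic_mem_symDiagCone_iff] at hg hg'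
  rw [quintic_add] at hsum
  obtain ⟨e1, e2, e3, e4⟩ := quintic_inj hsum
  obtain ⟨k, hk, a1, a2, a3, a4⟩ := key _ _ _ _ _ _ _ _ hg hg' e1 e2 e3 e4
  obtain ⟨l, hl, b1, b2, b3, b4⟩ := key _ _ _ _ _ _ _ _ hg' hg (by linarith) (by linarith)
    (by linarith) (by linarith)
  constructor
  · exact ⟨k, hk, by rw [smul_quintic, a1, a2, a3, a4]⟩
  · exact ⟨l, hl, by rw [smul_quintic, b1, b2, b3, b4]⟩

theorem quintic_ne_zero {c p q r : ℝ} (h : ¬(c = 0 ∧ p = 0 ∧ q = 0 ∧ r = 0)) :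
    quintic c p q r ≠ 0 := fun h0 => h (quintic_inj (h0.trans quintic_zero.symm))

/-! ### Extremality of the listed quintics -/

/-- A summand of a quintic with zero leading coordinate has zero leading coordinate. -/
theorem leading_eq_zero {c₁ p₁ q₁ r₁ c₂ p₂ q₂ r₂ : ℝ} (h1 : Admissible c₁ p₁ q₁ r₁)
    (h2 : Admissible c₂ p₂ q₂ r₂) (h : c₁ + c₂ = 0) : c₁ = 0 ∧ c₂ = 0 := by
  have := h1.leading_nonneg
  have := h2.leading_nonneg
  constructor <;> linarith

/-- An interior zero of a nonnegative function is a minimum. This turns each shared zero into two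
linear conditions on a summand. -/
theorem quadratic_deriv_eq_zero {a b d x : ℝ} (h : ∀ y : ℝ, 0 < y → 0 ≤ a * y ^ 2 + b * y + d)
    (hx : 0 < x) (h0 : a * x ^ 2 + b * x + d = 0) : 2 * a * x + b = 0 := by
  have hmin : IsLocalMin (fun y : ℝ => a * y ^ 2 + b * y + d) x := by
    filter_upwards [lt_mem_nhds hx] with y hy
    rw [h0]
    exact h y hy
  have hd : HasDerivAt (fun y : ℝ => a * y ^ 2 + b * y + d) (2 * a * x + b) x := by
    refine ((((hasDerivAt_pow 2 x).const_mul a).add ((hasDerivAt_id x).const_mul b)).add_const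
      d).congr_deriv ?_
    norm_num; ring
  exact hmin.hasDerivAt_eq_zero hd

theorem quadratic_constant_nonneg {a b d : ℝ}
    (h : ∀ y : ℝ, 0 < y → 0 ≤ a * y ^ 2 + b * y + d) : 0 ≤ d := by
  have hc : Continuous fun y : ℝ => a * y ^ 2 + b * y + d := by fun_prop
  have ht := hc.continuousWithinAt (s := Set.Ioi 0) (x := 0)
  have h0 : a * (0 : ℝ) ^ 2 + b * 0 + d = d := by ring
  rw [ContinuousWithinAt, h0] at ht
  refine ge_of_tendsto ht ?_
  filter_upwards [self_mem_nhdsWithin] with y hy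
  exact h y hy

theorem Admissible.axis_quotient_nonneg {c p r : ℝ} (h : Admissible c p 0 r) {x : ℝ}
    (hx : 0 < x) : 0 ≤ c * x ^ 2 + (2 * p - 4 * c) * x + r := by
  have := h.2 x hx.le
  refine nonneg_of_mul_nonneg_right (a := x) ?_ hx
  linarith

theorem Admissible.axis_coeff_nonneg {c p r : ℝ} (h : Admissible c p 0 r) : 0 ≤ r :=
  quadratic_constant_nonneg fun _ hy => h.axis_quotient_nonneg hy

/-- This is the behaviour of `r x + 2q` at infinity, seen through `x = y⁻¹`. -/
theorem Admissible.axis_coeff_nonneg' {q r : ℝ} (h : Admissible 0 0 q r) : 0 ≤ r := by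
  refine quadratic_constant_nonneg (a := 0) (b := 2 * q) fun y hy => ?_
  have h1 := h.2 y⁻¹ (by positivity)
  have h2 : 0 * y ^ 2 + 2 * q * y + r =
      y * (0 * y⁻¹ ^ 3 + (2 * 0 - 4 * 0) * y⁻¹ ^ 2 + r * y⁻¹ + 2 * q) := by
    field_simp; ring
  rw [h2]
  positivity

theorem isExtremalElement_eC {t : ℝ} (h0 : 0 ≤ t) (h2 : t ≤ 2) :
    IsExtremalElement (symDiagCone 3 5) (eC t) := by
  rw [eC_eq_quintic]
  refine isExtremalElement_quintic (admissible_eC h2) (quintic_ne_zero (by simp)) ?_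
  intro c₁ p₁ q₁ r₁ c₂ p₂ q₂ r₂ h₁ h₂ hc hp hq hr
  have hq1 : q₁ = 0 := by linarith [h₁.constant_nonneg, h₂.constant_nonneg]
  have hq2 : q₂ = 0 := by linarith
  subst hq1 hq2
  refine ⟨c₁, h₁.leading_nonneg, by ring, ?_⟩
  -- For `t = 0` the double zero of the cubic over `x` sits at the endpoint, where no derivative
  -- argument applies. Instead the linear coefficients `2p - 4c` of both summands are nonnegative
  -- with sum zero.
  rcases h0.eq_or_lt with rfl | h0
  · have hr1 : r₁ = 0 := by nlinarith [h₁.axis_coeff_nonneg, h₂.axis_coeff_nonneg]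
    have hr2 : r₂ = 0 := by linarith
    subst hr1 hr2
    have key {c p : ℝ} (h : Admissible c p 0 0) : 0 ≤ 2 * p - 4 * c := by
      refine quadratic_constant_nonneg (a := 0) (b := c) fun y hy => ?_
      have := h.axis_quotient_nonneg hy
      refine nonneg_of_mul_nonneg_right (a := y) ?_ hy
      linarith
    have k1 := key h₁
    have k2 := key h₂
    refine ⟨by linarith, by ring, by ring⟩
  · have z1 := h₁.axis_quotient_nonneg h0
    have z2 := h₂.axis_quotient_nonneg h0
    have hz : c₁ * t ^ 2 + (2 * p₁ - 4 * c₁) * t + r₁ +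
        (c₂ * t ^ 2 + (2 * p₂ - 4 * c₂) * t + r₂) = 0 := by
      linear_combination (t ^ 2 - 4 * t) * hc + 2 * t * hp + hr
    have z : c₁ * t ^ 2 + (2 * p₁ - 4 * c₁) * t + r₁ = 0 := by linarith
    have hd := quadratic_deriv_eq_zero (fun y hy => h₁.axis_quotient_nonneg hy) h0 z
    refine ⟨by linarith, by ring, ?_⟩
    linear_combination z - t * hd

theorem isExtremalElement_eB {t : ℝ} (ht : 2 ≤ t) :
    IsExtremalElement (symDiagCone 3 5) (eB t (muB t)) := by
  obtain ⟨hw, hrel⟩ := muR_spec ht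
  rw [eB_muB_eq_quintic ht]
  generalize muR t - 2 = w at *
  have ht0 : 0 < t := by linarith
  -- At `w = 0` the boundary zero is not interior; this forces `t = 2`, where the form equals `eC
  -- 2`.
  rcases hw.eq_or_lt with rfl | hw
  · have ht2 : t = 2 := by
      have : t ^ 2 * (t - 2) = 0 := by linarith
      rcases mul_eq_zero.1 this with h | h
      · nlinarith
      · linarith
    subst ht2
    have := isExtremalElement_eC zero_le_two le_rfl
    rw [eC_eq_quintic] at this
    convert this using 2 <;> norm_num
  · refine isExtremalElement_quintic (admissible_eB ht hrel) (quintic_ne_zero (by simp)) ?_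
    intro c₁ p₁ q₁ r₁ c₂ p₂ q₂ r₂ h₁ h₂ hc hp hq hr
    have y1 := h₁.1 w hw.le
    have y2 := h₂.1 w hw.le
    have hy : c₁ * w ^ 2 + p₁ * w + q₁ + (c₂ * w ^ 2 + p₂ * w + q₂) = 0 := by
      linear_combination w ^ 2 * hc + w * hp + hq
    have y : c₁ * w ^ 2 + p₁ * w + q₁ = 0 := by linarith
    have hd := quadratic_deriv_eq_zero (fun x hx => h₁.1 x hx.le) hw y
    have z1 := h₁.2 t ht0.le
    have z2 := h₂.2 t ht0.le
    have hr' : (r₁ + r₂) * t = t ^ 3 - 4 * w ^ 2 := by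
      rw [hr]; field_simp
    have hz : c₁ * t ^ 3 + (2 * p₁ - 4 * c₁) * t ^ 2 + r₁ * t + 2 * q₁ +
        (c₂ * t ^ 3 + (2 * p₂ - 4 * c₂) * t ^ 2 + r₂ * t + 2 * q₂) = 0 := by
      linear_combination (t ^ 3 - 4 * t ^ 2) * hc + 2 * t ^ 2 * hp + hr' + 2 * hq - 2 * hrel
    have z : c₁ * t ^ 3 + (2 * p₁ - 4 * c₁) * t ^ 2 + r₁ * t + 2 * q₁ = 0 := by linarith
    have hp1 : p₁ = c₁ * (-2 * w) := by linarith
    have hq1 : q₁ = c₁ * w ^ 2 := by linear_combination y - w * hd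
    refine ⟨c₁, h₁.leading_nonneg, by ring, hp1, hq1, ?_⟩
    subst hp1 hq1
    field_simp
    linear_combination z + 2 * c₁ * hrel

theorem isExtremalElement_eD {t : ℝ} (ht : 0 ≤ t) :
    IsExtremalElement (symDiagCone 3 5) (eD t) := by
  rw [eD_eq_quintic]
  refine isExtremalElement_quintic (admissible_eD t) (quintic_ne_zero (by simp)) ?_
  intro c₁ p₁ q₁ r₁ c₂ p₂ q₂ r₂ h₁ h₂ hc hp hq hr
  obtain ⟨rfl, rfl⟩ := leading_eq_zero h₁ h₂ hc
  refine ⟨p₁, h₁.linear_nonneg, by ring, by ring, ?_⟩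
  rcases ht.eq_or_lt with rfl | ht
  · have hq1 : q₁ = 0 := by linarith [h₁.constant_nonneg, h₂.constant_nonneg]
    have hq2 : q₂ = 0 := by linarith
    subst hq1 hq2
    have := h₁.axis_coeff_nonneg
    have := h₂.axis_coeff_nonneg
    exact ⟨by ring, by linarith⟩
  · have key {p q r : ℝ} (h : Admissible 0 p q r) (x : ℝ) (hx : 0 < x) :
        0 ≤ 2 * p * x ^ 2 + r * x + 2 * q := by
      have := h.2 x hx.le
      linarith
    have z1 := key h₁ t ht
    have z2 := key h₂ t ht
    have hz : 2 * p₁ * t ^ 2 + r₁ * t + 2 * q₁ + (2 * p₂ * t ^ 2 + r₂ * t + 2 * q₂) = 0 := by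
      linear_combination 2 * t ^ 2 * hp + t * hr + 2 * hq
    have z : 2 * p₁ * t ^ 2 + r₁ * t + 2 * q₁ = 0 := by linarith
    have hd := quadratic_deriv_eq_zero (key h₁) ht z
    refine ⟨?_, by linarith⟩
    linear_combination z / 2 - t / 2 * hd

theorem isExtremalElement_eDInf : IsExtremalElement (symDiagCone 3 5) eDInf := by
  rw [eDInf_eq_quintic]
  refine isExtremalElement_quintic admissible_eDInf (quintic_ne_zero (by simp)) ?_
  intro c₁ p₁ q₁ r₁ c₂ p₂ q₂ r₂ h₁ h₂ hc hp hq hr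
  obtain ⟨rfl, rfl⟩ := leading_eq_zero h₁ h₂ hc
  have hp1 : p₁ = 0 := by linarith [h₁.linear_nonneg, h₂.linear_nonneg]
  have hp2 : p₂ = 0 := by linarith
  subst hp1 hp2
  have := h₁.axis_coeff_nonneg'
  have := h₂.axis_coeff_nonneg'
  exact ⟨q₁, h₁.constant_nonneg, by ring, by ring, by ring, by linarith⟩

theorem isExtremalElement_s3 : IsExtremalElement (symDiagCone 3 5) s3 := by
  rw [s3_eq_quintic]
  refine isExtremalElement_quintic admissible_s3 (quintic_ne_zero (by simp)) ?_
  intro c₁ p₁ q₁ r₁ c₂ p₂ q₂ r₂ h₁ h₂ hc hp hq hr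
  obtain ⟨rfl, rfl⟩ := leading_eq_zero h₁ h₂ hc
  have hp1 : p₁ = 0 := by linarith [h₁.linear_nonneg, h₂.linear_nonneg]
  have hq1 : q₁ = 0 := by linarith [h₁.constant_nonneg, h₂.constant_nonneg]
  subst hp1 hq1
  exact ⟨r₁, h₁.axis_coeff_nonneg', by ring, by ring, by ring, by ring⟩

/-! ### Every extremal ray is listed -/

/-- The rays of the classification. -/
def IsListedRay (R : Set (MvPolynomial (Fin 3) ℝ)) : Prop :=
  (∃ t : ℝ, 2 ≤ t ∧ R = ray (eB t (muB t))) ∨ (∃ t : ℝ, 0 ≤ t ∧ t ≤ 2 ∧ R = ray (eC t)) ∨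
    (∃ t : ℝ, 0 ≤ t ∧ R = ray (eD t)) ∨ R = ray eDInf ∨ R = ray s3

section Classification

variable {c p q r : ℝ}

theorem ray_eq_eB {t k w : ℝ} (hf : IsExtremalElement (symDiagCone 3 5) (quintic c p q r))
    (ht : 2 ≤ t) (hw : 0 ≤ w) (hrel : w ^ 2 + 2 * t ^ 2 * w = t ^ 2 * (t - 2)) (hk : 0 < k)
    (h : Admissible (c - k) (p + 2 * k * w) (q - k * w ^ 2) (r - k * (t ^ 2 - 4 * w ^ 2 / t))) :
    IsListedRay (ray (quintic c p q r)) := by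
  refine Or.inl ⟨t, ht, ?_⟩
  rw [eB_muB_eq_quintic ht, muR_sub_two_eq ht hw hrel]
  refine ray_quintic_eq hf hk (admissible_eB ht hrel) (quintic_ne_zero (by simp)) ?_
  convert h using 1 <;> ring

theorem ray_eq_eC {t k : ℝ} (hf : IsExtremalElement (symDiagCone 3 5) (quintic c p q r))
    (ht : 0 ≤ t) (ht2 : t ≤ 2) (hk : 0 < k)
    (h : Admissible (c - k) (p - k * (2 - t)) q (r - k * t ^ 2)) :
    IsListedRay (ray (quintic c p q r)) := by
  refine Or.inr <| Or.inl ⟨t, ht, ht2, ?_⟩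
  rw [eC_eq_quintic]
  refine ray_quintic_eq hf hk (admissible_eC ht2) (quintic_ne_zero (by simp)) ?_
  convert h using 1 <;> ring

theorem ray_eq_eD {t k : ℝ} (hf : IsExtremalElement (symDiagCone 3 5) (quintic c p q r))
    (ht : 0 ≤ t) (hk : 0 < k) (h : Admissible c (p - k) (q - k * t ^ 2) (r + 4 * k * t)) :
    IsListedRay (ray (quintic c p q r)) := by
  refine Or.inr <| Or.inr <| Or.inl ⟨t, ht, ?_⟩
  rw [eD_eq_quintic]
  refine ray_quintic_eq hf hk (admissible_eD t) (quintic_ne_zero (by simp)) ?_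
  convert h using 1 <;> ring

theorem ray_eq_eDInf {k : ℝ} (hf : IsExtremalElement (symDiagCone 3 5) (quintic c p q r))
    (hk : 0 < k) (h : Admissible c p (q - k) r) : IsListedRay (ray (quintic c p q r)) := by
  refine Or.inr <| Or.inr <| Or.inr <| Or.inl ?_
  rw [eDInf_eq_quintic]
  refine ray_quintic_eq hf hk admissible_eDInf (quintic_ne_zero (by simp)) ?_
  convert h using 1 <;> ring

theorem ray_eq_s3 {k : ℝ} (hf : IsExtremalElement (symDiagCone 3 5) (quintic c p q r))
    (hk : 0 < k) (h : Admissible c p q (r - k)) : IsListedRay (ray (quintic c p q r)) := by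
  refine Or.inr <| Or.inr <| Or.inr <| Or.inr ?_
  rw [s3_eq_quintic]
  refine ray_quintic_eq hf hk admissible_s3 (quintic_ne_zero (by simp)) ?_
  convert h using 1 <;> ring

theorem admissible_zero : Admissible 0 0 0 0 :=
  ⟨fun x _ => by simp, fun x _ => by simp⟩

/-- With `p = a²` and `q = b²`, the axis polynomial is `2(a x - b)² + (r + 4ab) x`. An excess of `r`
over `-4ab` splits off `s3`; without excess the form is a multiple of `eD (b / a)`, or of `eDInf` if
`a = 0`. -/
theorem isListedRay_of_leading_eq_zero
    (hf : IsExtremalElement (symDiagCone 3 5) (quintic 0 p q r)) :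
    IsListedRay (ray (quintic 0 p q r)) := by
  have h := quintic_mem_symDiagCone_iff.1 hf.1
  obtain ⟨a, ha, rfl⟩ : ∃ a : ℝ, 0 ≤ a ∧ p = a ^ 2 :=
    ⟨√p, Real.sqrt_nonneg _, (Real.sq_sqrt h.linear_nonneg).symm⟩
  obtain ⟨b, hb, rfl⟩ : ∃ b : ℝ, 0 ≤ b ∧ q = b ^ 2 :=
    ⟨√q, Real.sqrt_nonneg _, (Real.sq_sqrt h.constant_nonneg).symm⟩
  rcases lt_or_ge (-4 * (a * b)) r with hr | hr
  · refine ray_eq_s3 hf (k := r + 4 * (a * b)) (by linarith) ⟨h.1, fun x _ => ?_⟩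
    have := sq_nonneg (a * x - b)
    linarith
  · rcases ha.eq_or_lt with rfl | ha
    · norm_num at h hf hr ⊢
      have hr0 : r = 0 := le_antisymm hr h.axis_coeff_nonneg'
      subst hr0
      have hb0 : b ≠ 0 := by
        rintro rfl
        exact hf.2.1 (by simpa using quintic_zero)
      refine ray_eq_eDInf hf (k := b ^ 2) (by positivity) ?_
      rw [sub_self]
      exact admissible_zero
    · refine ray_eq_eD hf (t := b / a) (k := a ^ 2) (by positivity) (by positivity) ?_
      have hr4 : r = -4 * (a * b) := by
        refine le_antisymm hr ?_
        rcases hb.eq_or_lt with rfl | hb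
        · norm_num at h ⊢
          exact h.axis_coeff_nonneg
        · have h1 := h.2 (b / a) (by positivity)
          have h2 : 0 * (b / a) ^ 3 + (2 * a ^ 2 - 4 * 0) * (b / a) ^ 2 + r * (b / a) + 2 * b ^ 2 =
              (r + 4 * (a * b)) * (b / a) := by
            field_simp; ring
          rw [h2] at h1
          have := nonneg_of_mul_nonneg_left h1 (by positivity)
          linarith
      have e1 : b ^ 2 - a ^ 2 * (b / a) ^ 2 = 0 := by field_simp; ring
      have e2 : r + 4 * a ^ 2 * (b / a) = 0 := by rw [hr4]; field_simp; ring
      rw [e1, e2, sub_self]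
      exact admissible_zero

/-- Subtract `c • eC t` with `t = 2 - p / c`, which leaves a multiple of `s3`. If `p ≥ 2c`, this `t`
is not positive and `t = 0` is used instead. -/
theorem isListedRay_of_constant_eq_zero (hc : 0 < c)
    (hf : IsExtremalElement (symDiagCone 3 5) (quintic c p 0 r)) :
    IsListedRay (ray (quintic c p 0 r)) := by
  have h := quintic_mem_symDiagCone_iff.1 hf.1
  rcases lt_or_ge p (2 * c) with hp | hp
  · have hp0 : 0 ≤ p := by
      refine quadratic_constant_nonneg (a := 0) (b := c) fun y hy => ?_
      have := h.1 y hy.le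
      refine nonneg_of_mul_nonneg_right (a := y) ?_ hy
      linarith
    obtain ⟨t, rfl⟩ : ∃ t, p = c * (2 - t) := ⟨2 - p / c, by field_simp; ring⟩
    have ht : 0 < t := by nlinarith
    have ht2 : t ≤ 2 := by nlinarith
    refine ray_eq_eC hf ht.le ht2 hc ⟨fun x _ => by simp, fun x hx => ?_⟩
    have h1 := h.axis_quotient_nonneg ht
    have h2 : 0 ≤ r - c * t ^ 2 := by linarith
    have := mul_nonneg h2 hx
    linarith
  · refine ray_eq_eC hf le_rfl zero_le_two hc ⟨fun x hx => ?_, fun x hx => ?_⟩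
    · nlinarith
    · have := h.axis_coeff_nonneg
      have := mul_nonneg this hx
      have := mul_nonneg (sub_nonneg.2 hp) (sq_nonneg x)
      linarith

/-- The equation says that the derivative of the axis cubic divided by its variable vanishes at `t`.
-/
theorem exists_axis_minimizer (hc : 0 < c) (hq : 0 < q) :
    ∃ t : ℝ, 0 < t ∧ c * t ^ 3 + (p - 2 * c) * t ^ 2 - q = 0 := by
  set M := 1 + (|p - 2 * c| + q) / c with hM
  have hM1 : 1 ≤ M := by
    have : 0 ≤ (|p - 2 * c| + q) / c := by positivity
    linarith
  have hcM : c * M = c + |p - 2 * c| + q := by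
    rw [hM]; field_simp; ring
  have hcont : ContinuousOn (fun t : ℝ => c * t ^ 3 + (p - 2 * c) * t ^ 2 - q)
      (Set.Icc 0 M) := by fun_prop
  have hval : 0 ≤ c * M ^ 3 + (p - 2 * c) * M ^ 2 - q := by
    have h1 : c * M ^ 3 + (p - 2 * c) * M ^ 2 - q =
        M ^ 2 * (c + (|p - 2 * c| + (p - 2 * c))) + (M ^ 2 - 1) * q := by
      linear_combination M ^ 2 * hcM
    have h2 := neg_abs_le (p - 2 * c)
    have h3 : 0 ≤ M ^ 2 - 1 := by nlinarith
    rw [h1]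
    have h4 : 0 ≤ c + (|p - 2 * c| + (p - 2 * c)) := by linarith
    positivity
  obtain ⟨t, ⟨ht, _⟩, h0⟩ := intermediate_value_Icc (by linarith : (0 : ℝ) ≤ M) hcont
    ⟨by simpa using hq.le, hval⟩
  refine ⟨t, lt_of_le_of_ne ht ?_, h0⟩
  rintro rfl
  simp at h0
  exact hq.ne' h0

/-- The least `r` that the axis allows is `c t² - 4q / t`, and any excess splits off `s3`. At the
least value the cubic has a double root at `t`, so a little of `eD t` can be removed unless the
boundary quadratic also has a double root `w ≥ 0`. In that case the form is a multiple of `eB`. -/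
theorem isListedRay_of_pos (hc : 0 < c) (hq : 0 < q)
    (hf : IsExtremalElement (symDiagCone 3 5) (quintic c p q r)) :
    IsListedRay (ray (quintic c p q r)) := by
  have h := quintic_mem_symDiagCone_iff.1 hf.1
  obtain ⟨t, ht, h0⟩ := exists_axis_minimizer (p := p) hc hq
  have factor (x : ℝ) : c * x ^ 3 + (2 * p - 4 * c) * x ^ 2 + (c * t ^ 2 - 4 * q / t) * x + 2 * q =
      (x - t) ^ 2 * (c * x + 2 * (q / t ^ 2)) := by
    field_simp
    linear_combination 2 * x ^ 2 * h0
  have hr : c * t ^ 2 - 4 * q / t ≤ r := by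
    have h1 := h.2 t ht.le
    have h2 := factor t
    rw [sub_self, zero_pow two_ne_zero, zero_mul] at h2
    have h3 : 0 ≤ (r - (c * t ^ 2 - 4 * q / t)) * t := by linarith
    linarith [nonneg_of_mul_nonneg_left h3 ht]
  rcases hr.lt_or_eq with hr | hr
  · refine ray_eq_s3 hf (k := r - (c * t ^ 2 - 4 * q / t)) (by linarith)
      ⟨h.1, fun x hx => ?_⟩
    rw [sub_sub_cancel, factor]
    positivity
  -- The cubic of `eD t` is `2(x - t)²`, so subtracting `ε • eD t` keeps the square factor and only
  -- lowers the cofactor.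
  have axis {ε : ℝ} (hε : ε * t ^ 2 ≤ q) {x : ℝ} (hx : 0 ≤ x) :
      0 ≤ c * x ^ 3 + (2 * (p - ε) - 4 * c) * x ^ 2 + (r + 4 * ε * t) * x
        + 2 * (q - ε * t ^ 2) := by
    have h1 : c * x ^ 3 + (2 * (p - ε) - 4 * c) * x ^ 2 + (r + 4 * ε * t) * x
        + 2 * (q - ε * t ^ 2) = (x - t) ^ 2 * (c * x + 2 * (q / t ^ 2 - ε)) := by
      rw [← hr]
      linear_combination factor x
    have h2 : 0 ≤ q / t ^ 2 - ε := by
      rw [sub_nonneg, le_div_iff₀ (by positivity)]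
      exact hε
    rw [h1]
    positivity
  have ht2 : 0 < t ^ 2 := by positivity
  rcases lt_or_ge 0 p with hp | hp
  · have hε : min p (q / t ^ 2) * t ^ 2 ≤ q := by
      rw [← le_div_iff₀ ht2]
      exact min_le_right _ _
    refine ray_eq_eD hf ht.le (k := min p (q / t ^ 2)) (lt_min hp (by positivity))
      ⟨fun x hx => ?_, fun x hx => axis hε hx⟩
    have h1 := mul_nonneg (sub_nonneg.2 (min_le_left p (q / t ^ 2))) hx
    have h2 : 0 ≤ c * x ^ 2 := by positivity
    linarith
  have hdisc : p ^ 2 ≤ 4 * c * q := by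
    have h1 := h.1 (-p / (2 * c)) (div_nonneg (by linarith) (by linarith))
    have h2 : c * (-p / (2 * c)) ^ 2 + p * (-p / (2 * c)) + q =
        (4 * c * q - p ^ 2) / (4 * c) := by
      field_simp; ring
    rw [h2] at h1
    by_contra! hlt
    exact absurd h1 (not_le.2 (div_neg_of_neg_of_pos (by linarith) (by linarith)))
  rcases hdisc.lt_or_eq with hd | hd
  -- Subtracting `ε • eD t` lowers `4cq - p²` by `ε (4ct² - 2p) + ε²`. As `ε ≤ 1`, the extra 1 in
  -- the denominator absorbs `ε²`.
  · set δ := (4 * c * q - p ^ 2) / (1 - 2 * p + 4 * c * t ^ 2) with hδ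
    have hden : 0 < 1 - 2 * p + 4 * c * t ^ 2 := by
      have : 0 < 4 * c * t ^ 2 := by positivity
      linarith
    have hδ0 : 0 < δ := div_pos (by linarith) hden
    set ε := min 1 (min δ (q / t ^ 2)) with hεdef
    have hε0 : 0 < ε := lt_min one_pos (lt_min hδ0 (by positivity))
    have hε1 : ε ≤ 1 := min_le_left _ _
    have hεδ : ε * (1 - 2 * p + 4 * c * t ^ 2) ≤ 4 * c * q - p ^ 2 := by
      rw [← le_div_iff₀ hden]
      exact (min_le_right _ _).trans (min_le_left _ _)
    have hεq : ε * t ^ 2 ≤ q := by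
      rw [← le_div_iff₀ ht2]
      exact (min_le_right _ _).trans (min_le_right _ _)
    refine ray_eq_eD hf ht.le hε0 ⟨fun x _ => ?_, fun x hx => axis hεq hx⟩
    have h1 : 4 * c * (c * x ^ 2 + (p - ε) * x + (q - ε * t ^ 2)) =
        (2 * c * x + (p - ε)) ^ 2 + (4 * c * q - p ^ 2 - ε * (1 - 2 * p + 4 * c * t ^ 2))
          + ε * (1 - ε) := by ring
    refine nonneg_of_mul_nonneg_right (a := 4 * c) ?_ (by positivity)
    rw [h1]
    have := mul_nonneg hε0.le (sub_nonneg.2 hε1)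
    have := sq_nonneg (2 * c * x + (p - ε))
    linarith
  -- The boundary quadratic is now `c (x - w)²`, and the equation for `t` becomes the relation
  -- defining `eB`.
  · obtain ⟨w, rfl⟩ : ∃ w, p = -2 * c * w := ⟨-p / (2 * c), by field_simp⟩
    have hw : 0 ≤ w := by
      by_contra! hw
      nlinarith
    have hqw : q = c * w ^ 2 := by
      have h1 : 4 * c * (q - c * w ^ 2) = 0 := by linear_combination -hd
      rcases mul_eq_zero.1 h1 with h2 | h2
      · linarith
      · linarith
    subst hqw
    have hrel : w ^ 2 + 2 * t ^ 2 * w = t ^ 2 * (t - 2) := by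
      have h1 : c * (w ^ 2 + 2 * t ^ 2 * w - t ^ 2 * (t - 2)) = 0 := by linear_combination -h0
      rcases mul_eq_zero.1 h1 with h2 | h2
      · linarith
      · linarith
    have ht2' : 2 ≤ t := by
      have h1 : 0 ≤ t ^ 2 * (t - 2) := by rw [← hrel]; positivity
      linarith [nonneg_of_mul_nonneg_right h1 ht2]
    refine ray_eq_eB hf ht2' hw hrel hc ?_
    have e1 : -2 * c * w + 2 * c * w = 0 := by ring
    have e2 : r - c * (t ^ 2 - 4 * w ^ 2 / t) = 0 := by rw [← hr]; ring
    rw [e1, e2, sub_self, sub_self]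
    exact admissible_zero

end Classification

theorem isListedRay_of_isExtremalElement {f : MvPolynomial (Fin 3) ℝ}
    (hf : IsExtremalElement (symDiagCone 3 5) f) : IsListedRay (ray f) := by
  obtain ⟨c, p, q, r, rfl⟩ := exists_eq_quintic hf.1.1
  have h := quintic_mem_symDiagCone_iff.1 hf.1
  rcases h.leading_nonneg.eq_or_lt with rfl | hc
  · exact isListedRay_of_leading_eq_zero hf
  rcases h.constant_nonneg.eq_or_lt with rfl | hq
  · exact isListedRay_of_constant_eq_zero hc hf
  · exact isListedRay_of_pos hc hq hf

end QuinticCone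

theorem theorem4p29 (R : Set (MvPolynomial (Fin 3) ℝ)) :
    QuinticCone.IsExtremalRay (QuinticCone.symDiagCone 3 5) R ↔
      (∃ t : ℝ, 2 ≤ t ∧ R = QuinticCone.ray (QuinticCone.eB t (QuinticCone.muB t))) ∨
      (∃ t : ℝ, 0 ≤ t ∧ t ≤ 2 ∧ R = QuinticCone.ray (QuinticCone.eC t)) ∨
      (∃ t : ℝ, 0 ≤ t ∧ R = QuinticCone.ray (QuinticCone.eD t)) ∨
      R = QuinticCone.ray QuinticCone.eDInf ∨
      R = QuinticCone.ray QuinticCone.s3 := by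
  constructor
  · rintro ⟨f, hf, rfl⟩
    exact QuinticCone.isListedRay_of_isExtremalElement hf
  · rintro (⟨t, ht, rfl⟩ | ⟨t, ht, ht2, rfl⟩ | ⟨t, ht, rfl⟩ | rfl | rfl)
    · exact ⟨_, QuinticCone.isExtremalElement_eB ht, rfl⟩
    · exact ⟨_, QuinticCone.isExtremalElement_eC ht ht2, rfl⟩
    · exact ⟨_, QuinticCone.isExtremalElement_eD ht, rfl⟩
    · exact ⟨_, QuinticCone.isExtremalElement_eDInf, rfl⟩
    · exact ⟨_, QuinticCone.isExtremalElement_s3, rfl⟩
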